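/- Let $d\ge 5$ and let $(S_k)_{k\ge 0}$ be the nearest neighbour symmetric (simple) random walk on $\mathbb{Z}^d$ with $S_0=0$ and law $\mathbb{P}_0$. For $n\in\mathbb{N}$ and $x\in\mathbb{Z}^d$ let $l_n(x)=\sum_{k=0}^n \mathbf 1\{S_k=x\}$ and $l_\infty(x)=\sum_{k\ge 0}\mathbf 1\{S_k=x\}$, let $G_d(x)=\mathbb{E}_0[l_\infty(x)]$ be the Green kernel, and for $0<b<a$ let $\mathcal D_{b,a}=\{x\in\mathbb{Z}^d:\ n^b\le l_n(x)<n^a\}$, with $|\mathcal D_{b,a}|$ its number of sites. (1) Let $b,\gamma,\delta,\zeta,y>0$ with $\zeta<(1-\frac2d)\gamma+b-\delta$, and assume one of the following: (i) $\gamma+2b>1$; (ii) $\gamma+2b=1$ and $y>1+\sum_{x\in\mathbb{Z}^d}G_d(x)^2$; (iii) $b>\frac2d\gamma$. Then for all sufficiently large $n$ (depending on $d,b,\gamma,\delta,\zeta,y$), $$\mathbb{P}_0\big(|\mathcal D_{b,b+\delta}|>n^\gamma y\big)\le \exp(-n^\zeta).$$ (2) If $b>\frac2d\gamma$, the exponent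 $\zeta=(1-\frac2d)\gamma+b$ is allowed as well, up to a constant: there is $\kappa>0$ depending only on $d$ such that for all $b,\gamma,\delta,y>0$ with $b>\frac2d\gamma$ and all sufficiently large $n$ (depending on $d,b,\gamma,\delta,y$), $$\mathbb{P}_0\big(|\mathcal D_{b,b+\delta}|>n^\gamma y\big)\le \exp\!\big(-\kappa\, y^{1-2/d}\, n^{(1-\frac2d)\gamma+b}\big).$$ In particular, the bound $\exp(-n^{(1-\frac2d)\gamma+b})$ holds when $y\ge \kappa^{-d/(d-2)}$. -/

import Mathlib

open MeasureTheory ProbabilityTheory Filter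
open scoped ENNReal

/-- The unit vectors `e_i` (sign `true`) and `-e_i` (sign `false`) of `ℤ^d`. -/
def srwStep {d : ℕ} (s : Fin d × Bool) : Fin d → ℤ :=
  Pi.single s.1 (if s.2 then 1 else -1)

/-- The law `P_0` of the nearest neighbour symmetric random walk on `ℤ^d`, realised on the space of
sequences of steps: the steps are independent, each uniform among the `2d` unit vectors. -/
noncomputable def srwLaw (d : ℕ) : Measure (ℕ → Fin d × Bool) :=
  Measure.infinitePi (fun _ : ℕ => uniformOn (Set.univ : Set (Fin d × Bool)))

instance srwLaw_isProbabilityMeasure (d : ℕ) [NeZero d] : IsProbabilityMeasure (srwLaw d) := by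
  unfold srwLaw; infer_instance

/-- The position `S_k` of the walk at time `k`, with `S_0 = 0`. -/
def srwPos {d : ℕ} (k : ℕ) (ω : ℕ → Fin d × Bool) : Fin d → ℤ :=
  ∑ i ∈ Finset.range k, srwStep (ω i)

/-- The local time `l_n(x)`: the number of `0 ≤ k ≤ n` with `S_k = x`. -/
def srwLocalTime {d : ℕ} (n : ℕ) (x : Fin d → ℤ) (ω : ℕ → Fin d × Bool) : ℕ :=
  ((Finset.range (n + 1)).filter (fun k => srwPos k ω = x)).card

/-- The total local time `l_∞(x)`: the number of `k ≥ 0` with `S_k = x`, possibly infinite. -/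
noncomputable def srwTotalLocalTime {d : ℕ} (x : Fin d → ℤ) (ω : ℕ → Fin d × Bool) : ℝ≥0∞ :=
  ∑' k : ℕ, if srwPos k ω = x then 1 else 0

/-- The Green kernel `G_d(x) = E_0[l_∞(x)]`. -/
noncomputable def srwGreen (d : ℕ) (x : Fin d → ℤ) : ℝ≥0∞ :=
  ∫⁻ ω, srwTotalLocalTime x ω ∂(srwLaw d)

/-- The level set `D_{b,a} = {x : n^b ≤ l_n(x) < n^a}`. -/
def srwLevelSet {d : ℕ} (n : ℕ) (b a : ℝ) (ω : ℕ → Fin d × Bool) : Set (Fin d → ℤ) :=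
  {x | (n : ℝ) ^ b ≤ (srwLocalTime n x ω : ℝ) ∧ (srwLocalTime n x ω : ℝ) < (n : ℝ) ^ a}

/-- For `n ≥ 1` level sets are finite, so that their number of sites is their `Set.ncard`. -/
theorem srwLevelSet_finite {d n : ℕ} (hn : 1 ≤ n) (b a : ℝ) (ω : ℕ → Fin d × Bool) :
    (srwLevelSet n b a ω).Finite := by
  refine ((Finset.range (n + 1)).image (fun k => srwPos k ω)).finite_toSet.subset ?_
  intro x hx
  have h0 : (0 : ℝ) < (n : ℝ) ^ b := Real.rpow_pos_of_pos (by exact_mod_cast hn) b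
  have h1 : 0 < srwLocalTime n x ω := by exact_mod_cast h0.trans_le hx.1
  obtain ⟨k, hk⟩ := Finset.card_pos.mp h1
  rw [Finset.mem_filter] at hk
  exact Finset.mem_coe.mpr (Finset.mem_image.mpr ⟨k, hk.1, hk.2⟩)

/-! A union bound over all possible level sets is too costly, so a sparse part of the level set is
used. Write `G(x, U)` for the Green potential of `U`. The heat kernel bound `p_k ≤ C k^{-d/2}` gives
`G(x, Λ) ≤ C |Λ|^{2/d}`, and an averaging argument then finds in every finite `Λ` a subset `U` of
any size `k ≤ c |Λ|^{1-2/d}` with `G(·, U) ≤ K` on `U` (`exists_subset_potential_le`).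

For such `U` the function `h = 1 + G(·, U)/K` is superharmonic for the walk weighted by `q = 1 +
1/(2K)` at each visit to `U`. Hence the occupation time of `U` has `q`-exponential moment at most
`h(0)`, uniformly in time (`lintegral_pow_localTime_le`).

If the level set has more than `n^γ y` sites, some `U` in it with `k` of order `(n^γ y)^{1-2/d}` is
occupied for time at least `k n^b`, which has probability at most `h(0) exp(-k n^b log q)`. There
are only `exp(O(k log n))` candidates `U`, a negligible factor because `b > 0`. This is
`exists_srwLaw_levelSet_le`, from which both claims follow. -/

/-- The transition probabilities of the simple random walk: `srwKernel k x` is the probability of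
going from `x` to `0` in `k` steps. -/
noncomputable def srwKernel {d : ℕ} : ℕ → (Fin d → ℤ) → ℝ
  | 0, x => if x = 0 then 1 else 0
  | k + 1, x => (∑ s : Fin d × Bool, srwKernel k (x + srwStep s)) / (2 * d)

theorem srwKernel_nonneg {d : ℕ} (k : ℕ) (x : Fin d → ℤ) : 0 ≤ srwKernel k x := by
  induction k generalizing x with
  | zero => simp only [srwKernel]; split_ifs <;> norm_num
  | succ k ih =>
    simp only [srwKernel]
    exact div_nonneg (Finset.sum_nonneg fun s _ => ih _) (by positivity)

theorem sum_srwKernel_sub_le_one {d : ℕ} (hd : 0 < d) (k : ℕ) (Λ : Finset (Fin d → ℤ))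
    (x : Fin d → ℤ) : ∑ y ∈ Λ, srwKernel k (x - y) ≤ 1 := by
  induction k generalizing x with
  | zero =>
    simp only [srwKernel, sub_eq_zero, Finset.sum_ite_eq]
    split_ifs <;> norm_num
  | succ k ih =>
    have h2 : (0 : ℝ) < 2 * d := by positivity
    simp only [srwKernel]
    rw [← Finset.sum_div, Finset.sum_comm, div_le_one h2]
    calc ∑ s : Fin d × Bool, ∑ y ∈ Λ, srwKernel k (x - y + srwStep s)
        ≤ ∑ _s : Fin d × Bool, (1 : ℝ) := by
          refine Finset.sum_le_sum fun s _ => ?_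
          have := ih (x + srwStep s)
          simpa only [add_sub_right_comm] using this
      _ = 2 * d := by simp [mul_comm]

/-! ### Fourier representation and heat kernel bound -/

/-- The uniform measure (of total mass `(2π)^d`) on the torus. -/
noncomputable def torusMeasure (d : ℕ) : Measure (Fin d → ℝ) :=
  Measure.pi fun _ => volume.restrict (Set.Ioc (-Real.pi) Real.pi)

instance (d : ℕ) : IsFiniteMeasure (torusMeasure d) := by
  unfold torusMeasure; infer_instance

/-- Orthogonality of characters: the complex exponential factors over the coordinates, and the
cosine is its real part. -/
theorem integral_torus_cos {d : ℕ} (x : Fin d → ℤ) :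
    ∫ θ, Real.cos (∑ i, θ i * x i) ∂(torusMeasure d) =
      (2 * Real.pi) ^ d * (if x = 0 then 1 else 0) := by
  have h1 : ∀ n : ℤ, ∫ t in Set.Ioc (-Real.pi) Real.pi, Complex.exp ((t * n : ℝ) * Complex.I) =
      if n = 0 then (2 * Real.pi : ℂ) else 0 := by
    intro n
    rw [← intervalIntegral.integral_of_le (by linarith [Real.pi_pos])]
    split_ifs with hn
    · subst hn
      simp only [Int.cast_zero, mul_zero, Complex.ofReal_zero, zero_mul, Complex.exp_zero,
        intervalIntegral.integral_const]
      rw [Complex.real_smul]; push_cast; ring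
    · have hc : (n * Complex.I : ℂ) ≠ 0 := by simp [hn]
      have := integral_exp_mul_complex (a := -Real.pi) (b := Real.pi) hc
      have e : ∀ t : ℝ, ((t * n : ℝ) : ℂ) * Complex.I = n * Complex.I * t := by
        intro t; push_cast; ring
      simp_rw [e, this]
      rw [div_eq_zero_iff]; left
      rw [sub_eq_zero, Complex.exp_eq_exp_iff_exists_int]
      exact ⟨n, by push_cast; ring⟩
  have h2 : ∫ θ, Complex.exp ((∑ i, θ i * x i : ℝ) * Complex.I) ∂(torusMeasure d) =
      (((2 * Real.pi) ^ d * (if x = 0 then 1 else 0) : ℝ) : ℂ) := by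
    have e : ∀ θ : Fin d → ℝ, Complex.exp ((∑ i, θ i * x i : ℝ) * Complex.I) =
        ∏ i, Complex.exp ((θ i * x i : ℝ) * Complex.I) := by
      intro θ
      rw [← Complex.exp_sum, Complex.ofReal_sum, Finset.sum_mul]
    simp_rw [e]
    rw [torusMeasure, integral_fintype_prod_eq_prod
      (f := fun i (t : ℝ) => Complex.exp ((t * x i : ℝ) * Complex.I))]
    simp_rw [h1]
    split_ifs with hx
    · subst hx; simp
    · obtain ⟨i, hi⟩ := Function.ne_iff.mp hx
      rw [Finset.prod_eq_zero (Finset.mem_univ i)]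
      · simp
      · simpa using hi
  have h3 : Integrable (fun θ : Fin d → ℝ => Complex.exp ((∑ i, θ i * x i : ℝ) * Complex.I))
      (torusMeasure d) := by
    refine Integrable.of_bound (C := 1) ?_ (Eventually.of_forall fun θ => ?_)
    · exact (by fun_prop : Continuous _).aestronglyMeasurable
    · rw [Complex.norm_exp_ofReal_mul_I]
  have h4 := integral_re h3
  simp only [RCLike.re_eq_complex_re, Complex.exp_ofReal_mul_I_re] at h4
  rw [h4, h2, Complex.ofReal_re]

/-- The characteristic function of one step. -/
noncomputable def srwSymbol {d : ℕ} (θ : Fin d → ℝ) : ℝ := (∑ i, Real.cos (θ i)) / d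

theorem continuous_srwSymbol {d : ℕ} : Continuous (srwSymbol (d := d)) := by
  unfold srwSymbol; fun_prop

theorem abs_srwSymbol_le_one {d : ℕ} (θ : Fin d → ℝ) : |srwSymbol θ| ≤ 1 := by
  unfold srwSymbol
  rw [abs_div, Nat.abs_cast]
  refine div_le_one_of_le₀ ?_ (by positivity)
  calc |∑ i, Real.cos (θ i)| ≤ ∑ i, |Real.cos (θ i)| := Finset.abs_sum_le_sum_abs _ _
    _ ≤ ∑ _i : Fin d, (1 : ℝ) := Finset.sum_le_sum fun i _ => Real.abs_cos_le_one _
    _ = d := by simp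

/-- Opposite steps cancel the sine terms, so each cosine wave is an eigenfunction of the step
operator. -/
theorem sum_cos_srwStep {d : ℕ} (θ : Fin d → ℝ) (x : Fin d → ℤ) :
    ∑ s : Fin d × Bool, Real.cos (∑ i, θ i * ((x + srwStep s) i : ℤ)) =
      2 * (∑ i, Real.cos (θ i)) * Real.cos (∑ i, θ i * x i) := by
  have e : ∀ s : Fin d × Bool, ∑ i, θ i * ((x + srwStep s) i : ℤ) =
      (∑ i, θ i * x i) + θ s.1 * (if s.2 then 1 else -1) := by
    intro s
    simp only [Pi.add_apply, Int.cast_add, mul_add, Finset.sum_add_distrib, srwStep]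
    congr 1
    rw [Finset.sum_eq_single s.1]
    · simp
    · intro i _ hi; simp [Pi.single_eq_of_ne hi]
    · simp
  simp_rw [e]
  rw [Fintype.sum_prod_type]
  simp only [Fintype.sum_bool, if_true, Bool.false_eq_true, if_false, mul_one, mul_neg]
  rw [Finset.mul_sum, Finset.sum_mul]
  refine Finset.sum_congr rfl fun i _ => ?_
  rw [← sub_eq_add_neg, Real.cos_add, Real.cos_sub]; ring

theorem integrable_srwSymbol_pow_mul {d : ℕ} (k : ℕ) (x : Fin d → ℤ) :
    Integrable (fun θ => srwSymbol θ ^ k * Real.cos (∑ i, θ i * x i)) (torusMeasure d) := by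
  refine Integrable.of_bound (C := 1) ?_ (Eventually.of_forall fun θ => ?_)
  · have := continuous_srwSymbol (d := d)
    exact (by fun_prop : Continuous _).aestronglyMeasurable
  · rw [Real.norm_eq_abs, abs_mul, abs_pow]
    exact mul_le_one₀ (pow_le_one₀ (abs_nonneg _) (abs_srwSymbol_le_one θ)) (abs_nonneg _)
      (Real.abs_cos_le_one _)

theorem integral_srwSymbol_pow_mul_cos {d : ℕ} (hd : 0 < d) (k : ℕ) (x : Fin d → ℤ) :
    ∫ θ, srwSymbol θ ^ k * Real.cos (∑ i, θ i * x i) ∂(torusMeasure d) =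
      (2 * Real.pi) ^ d * srwKernel k x := by
  induction k generalizing x with
  | zero => simp only [pow_zero, one_mul, srwKernel, integral_torus_cos]
  | succ k ih =>
    have h2 : (d : ℝ) ≠ 0 := by positivity
    have e : ∀ θ : Fin d → ℝ, srwSymbol θ ^ (k + 1) * Real.cos (∑ i, θ i * x i) =
        (∑ s : Fin d × Bool, srwSymbol θ ^ k *
          Real.cos (∑ i, θ i * ((x + srwStep s) i : ℤ))) / (2 * d) := by
      intro θ
      have hs : ∑ i, Real.cos (θ i) = srwSymbol θ * d := by rw [srwSymbol]; field_simp
      rw [← Finset.mul_sum, sum_cos_srwStep, pow_succ, hs]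
      field_simp
    simp_rw [e]
    rw [integral_div, integral_finsetSum _ fun s _ => integrable_srwSymbol_pow_mul k _]
    simp_rw [ih, srwKernel]
    rw [← Finset.mul_sum, mul_div_assoc]

/-- Read off from the evenness of the cosine in the Fourier formula. -/
theorem srwKernel_neg {d : ℕ} (hd : 0 < d) (k : ℕ) (x : Fin d → ℤ) :
    srwKernel k (-x) = srwKernel k x := by
  have h := integral_srwSymbol_pow_mul_cos hd k (-x)
  simp only [Pi.neg_apply, Int.cast_neg, mul_neg, Finset.sum_neg_distrib, Real.cos_neg] at h
  rw [integral_srwSymbol_pow_mul_cos hd k x] at h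
  exact (mul_left_cancel₀ (by positivity) h).symm

/-- The absolute value is there because the walk has period two: the symbol has modulus 1 at `(π, …,
π)` as well as at 0. Jordan's inequality gives a Gaussian bound around each of `0, π, -π`, whence
the factor 3. -/
theorem integral_exp_abs_cos_le {t : ℝ} (ht : 0 < t) :
    ∫ θ in Set.Ioc (-Real.pi) Real.pi, Real.exp (-t * (1 - |Real.cos θ|)) ≤
      3 * (Real.pi * √(Real.pi / (2 * t))) := by
  have hπ := Real.pi_pos
  set a : ℝ := 2 * t / Real.pi ^ 2 with ha
  have ha0 : 0 < a := by positivity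
  have key : ∀ u : ℝ, |u| ≤ Real.pi / 2 →
      Real.exp (-t * (1 - |Real.cos u|)) ≤ Real.exp (-a * u ^ 2) := by
    intro u hu
    apply Real.exp_le_exp.mpr
    have h1 := Real.mul_abs_le_abs_sin hu
    have h2 : (2 / Real.pi * |u|) ^ 2 ≤ Real.sin u ^ 2 := by
      rw [← sq_abs (Real.sin u)]
      exact pow_le_pow_left₀ (by positivity) h1 2
    have h3 := Real.sin_sq_add_cos_sq u
    have h4 := Real.abs_cos_le_one u
    have h5 : Real.cos u ^ 2 = |Real.cos u| ^ 2 := (sq_abs _).symm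
    have h6 : (2 / Real.pi * |u|) ^ 2 = 4 / Real.pi ^ 2 * u ^ 2 := by
      rw [mul_pow, sq_abs, div_pow]; norm_num
    have h7 : 2 / Real.pi ^ 2 * u ^ 2 ≤ 1 - |Real.cos u| := by
      have : 4 / Real.pi ^ 2 * u ^ 2 = 2 * (2 / Real.pi ^ 2 * u ^ 2) := by ring
      nlinarith [abs_nonneg (Real.cos u)]
    calc -t * (1 - |Real.cos u|) ≤ -t * (2 / Real.pi ^ 2 * u ^ 2) := by nlinarith
      _ = -a * u ^ 2 := by rw [ha]; ring
  have hint : ∀ c : ℝ, Integrable fun θ : ℝ => Real.exp (-a * (θ + c) ^ 2) := fun c =>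
    (integrable_exp_neg_mul_sq ha0).comp_add_right c
  have hval : ∀ c : ℝ, ∫ θ : ℝ, Real.exp (-a * (θ + c) ^ 2) = Real.pi * √(Real.pi / (2 * t)) := by
    intro c
    rw [integral_add_right_eq_self (fun θ : ℝ => Real.exp (-a * θ ^ 2)) c, integral_gaussian]
    have : Real.pi / a = Real.pi ^ 2 * (Real.pi / (2 * t)) := by rw [ha]; field_simp
    rw [this, Real.sqrt_mul (by positivity), Real.sqrt_sq hπ.le]
  set F : ℝ → ℝ := fun θ => Real.exp (-a * (θ + 0) ^ 2) + Real.exp (-a * (θ + -Real.pi) ^ 2) +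
    Real.exp (-a * (θ + Real.pi) ^ 2) with hF
  have hFi : Integrable F := ((hint 0).add (hint _)).add (hint _)
  have hFv : ∫ θ, F θ = 3 * (Real.pi * √(Real.pi / (2 * t))) := by
    have e1 := integral_add ((hint 0).add (hint (-Real.pi))) (hint Real.pi)
    have e2 := integral_add (hint 0) (hint (-Real.pi))
    simp only [Pi.add_apply] at e1 e2
    rw [hF]
    dsimp only
    rw [e1, e2, hval, hval, hval]; ring
  rw [← hFv]
  calc ∫ θ in Set.Ioc (-Real.pi) Real.pi, Real.exp (-t * (1 - |Real.cos θ|))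
      ≤ ∫ θ in Set.Ioc (-Real.pi) Real.pi, F θ := by
        refine setIntegral_mono_on ?_ hFi.integrableOn measurableSet_Ioc fun θ hθ => ?_
        · exact ((by fun_prop : Continuous fun θ : ℝ => Real.exp (-t * (1 - |Real.cos θ|)))
            |>.integrableOn_Icc).mono_set Set.Ioc_subset_Icc_self
        · have p0 := Real.exp_pos (-a * (θ + 0) ^ 2)
          have p1 := Real.exp_pos (-a * (θ + -Real.pi) ^ 2)
          have p2 := Real.exp_pos (-a * (θ + Real.pi) ^ 2)
          have c1 : |Real.cos (θ + -Real.pi)| = |Real.cos θ| := by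
            rw [← sub_eq_add_neg, Real.cos_sub_pi, abs_neg]
          have c2 : |Real.cos (θ + Real.pi)| = |Real.cos θ| := by
            rw [Real.cos_add_pi, abs_neg]
          have b := hθ.1
          have b' := hθ.2
          rcases le_or_gt (Real.pi / 2) θ with h | h
          · have := key (θ + -Real.pi) (abs_le.mpr ⟨by linarith, by linarith⟩)
            rw [c1] at this
            simp only [hF]; linarith
          · rcases le_or_gt (-(Real.pi / 2)) θ with h' | h'
            · have := key (θ + 0) (abs_le.mpr ⟨by linarith, by linarith⟩)
              rw [add_zero] at this
              simp only [hF, add_zero] at *; linarith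
            · have := key (θ + Real.pi) (abs_le.mpr ⟨by linarith, by linarith⟩)
              rw [c2] at this
              simp only [hF]; linarith
    _ ≤ ∫ θ, F θ := by
        refine setIntegral_le_integral hFi (Eventually.of_forall fun θ => ?_)
        simp only [hF, Pi.zero_apply]; positivity

/-- The on-diagonal heat kernel bound `p_k(x) ≤ C k^{-d/2}`. -/
theorem exists_srwKernel_le {d : ℕ} (hd : 0 < d) :
    ∃ C : ℝ, 0 < C ∧ ∀ k : ℕ, 0 < k → ∀ x : Fin d → ℤ, srwKernel k x ≤ (C / √k) ^ d := by
  have hπ := Real.pi_pos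
  have hd' : (0 : ℝ) < d := by exact_mod_cast hd
  refine ⟨3 / 2 * √(Real.pi * d / 2), by positivity, fun k hk x => ?_⟩
  have hk' : (0 : ℝ) < k := by exact_mod_cast hk
  have hpt : ∀ θ : Fin d → ℝ, |srwSymbol θ| ^ k ≤
      ∏ i, Real.exp (-(k / d : ℝ) * (1 - |Real.cos (θ i)|)) := by
    intro θ
    have h1 : |srwSymbol θ| ≤ (∑ i, |Real.cos (θ i)|) / d := by
      rw [srwSymbol, abs_div, Nat.abs_cast]
      gcongr
      exact Finset.abs_sum_le_sum_abs _ _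
    -- The inequality `u ≤ exp (u - 1)` turns an average over coordinates into a product, so the
    -- torus integral factors.
    have h2 : |srwSymbol θ| ≤ Real.exp ((∑ i, |Real.cos (θ i)|) / d - 1) :=
      h1.trans (by linarith [Real.add_one_le_exp ((∑ i, |Real.cos (θ i)|) / d - 1)])
    calc |srwSymbol θ| ^ k ≤ Real.exp ((∑ i, |Real.cos (θ i)|) / d - 1) ^ k := by gcongr
      _ = ∏ i, Real.exp (-(k / d : ℝ) * (1 - |Real.cos (θ i)|)) := by
        rw [← Real.exp_nat_mul, ← Real.exp_sum, ← Finset.mul_sum, Finset.sum_sub_distrib]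
        congr 1
        simp only [Finset.sum_const, Finset.card_univ, Fintype.card_fin, nsmul_eq_mul, mul_one]
        field_simp; ring
  have hle : (2 * Real.pi) ^ d * srwKernel k x ≤
      (3 * (Real.pi * √(Real.pi / (2 * (k / d : ℝ))))) ^ d := by
    rw [← integral_srwSymbol_pow_mul_cos hd]
    calc ∫ θ, srwSymbol θ ^ k * Real.cos (∑ i, θ i * x i) ∂(torusMeasure d)
        ≤ ∫ θ : Fin d → ℝ, ∏ i, Real.exp (-(k / d : ℝ) * (1 - |Real.cos (θ i)|))
            ∂(torusMeasure d) := by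
          refine integral_mono (integrable_srwSymbol_pow_mul k x) ?_ fun θ => ?_
          · refine Integrable.of_bound (C := 1) ?_ (Eventually.of_forall fun θ => ?_)
            · exact (by fun_prop : Continuous _).aestronglyMeasurable
            · rw [Real.norm_eq_abs, abs_of_nonneg (by positivity)]
              refine Finset.prod_le_one (fun i _ => by positivity) fun i _ => ?_
              apply Real.exp_le_one_iff.mpr
              have := Real.abs_cos_le_one (θ i)
              have : 0 ≤ (k / d : ℝ) := by positivity
              nlinarith
          · refine le_trans ?_ (hpt θ)
            calc srwSymbol θ ^ k * Real.cos (∑ i, θ i * x i)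
                ≤ |srwSymbol θ ^ k * Real.cos (∑ i, θ i * x i)| := le_abs_self _
              _ = |srwSymbol θ| ^ k * |Real.cos (∑ i, θ i * x i)| := by rw [abs_mul, abs_pow]
              _ ≤ |srwSymbol θ| ^ k * 1 := by gcongr; exact Real.abs_cos_le_one _
              _ = _ := mul_one _
      _ = (∫ θ in Set.Ioc (-Real.pi) Real.pi,
            Real.exp (-(k / d : ℝ) * (1 - |Real.cos θ|))) ^ d := by
          rw [torusMeasure, integral_fintype_prod_eq_pow
            (f := fun t : ℝ => Real.exp (-(k / d : ℝ) * (1 - |Real.cos t|))), Fintype.card_fin]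
      _ ≤ _ := by
          refine pow_le_pow_left₀ (integral_nonneg fun θ => (Real.exp_pos _).le) ?_ d
          exact integral_exp_abs_cos_le (by positivity)
  have hfin : 3 * (Real.pi * √(Real.pi / (2 * (k / d : ℝ)))) =
      (2 * Real.pi) * (3 / 2 * √(Real.pi * d / 2) / √k) := by
    have : Real.pi / (2 * (k / d : ℝ)) = (Real.pi * d / 2) / k := by field_simp
    rw [this, Real.sqrt_div (by positivity)]
    ring
  rw [hfin, mul_pow (2 * Real.pi) (_ / _)] at hle
  exact le_of_mul_le_mul_left hle (by positivity)

/-! ### Green function and potentials of finite sets -/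

/-- The Green function `∑_k p_k(x)` of the simple random walk, as a real number. -/
noncomputable def srwPotential {d : ℕ} (x : Fin d → ℤ) : ℝ := ∑' k, srwKernel k x

theorem summable_srwKernel {d : ℕ} (hd : 4 ≤ d) (x : Fin d → ℤ) :
    Summable fun k => srwKernel k x := by
  obtain ⟨C, hC, h⟩ := exists_srwKernel_le (d := d) (by omega)
  refine Summable.of_norm_bounded_eventually_nat
    (g := fun k : ℕ => C ^ d * (1 / (k : ℝ) ^ 2)) ?_ ?_
  · exact (Real.summable_one_div_nat_pow.mpr (by norm_num)).mul_left _
  · filter_upwards [eventually_ge_atTop 1] with k hk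
    rw [Real.norm_eq_abs, abs_of_nonneg (srwKernel_nonneg k x)]
    refine (h k hk x).trans ?_
    have hk' : (1 : ℝ) ≤ k := by exact_mod_cast hk
    have h1 : 1 ≤ √(k : ℝ) := Real.one_le_sqrt.mpr hk'
    rw [div_pow, div_eq_mul_one_div]
    gcongr
    calc (k : ℝ) ^ 2 = √(k : ℝ) ^ 4 := by
          rw [show 4 = 2 * 2 from rfl, pow_mul, Real.sq_sqrt (by linarith)]
      _ ≤ √(k : ℝ) ^ d := pow_le_pow_right₀ h1 hd

theorem srwPotential_nonneg {d : ℕ} (x : Fin d → ℤ) : 0 ≤ srwPotential x :=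
  tsum_nonneg fun k => srwKernel_nonneg k x

theorem srwPotential_neg {d : ℕ} (hd : 0 < d) (x : Fin d → ℤ) :
    srwPotential (-x) = srwPotential x := by
  simp only [srwPotential, srwKernel_neg hd]

theorem one_le_srwPotential_zero {d : ℕ} (hd : 4 ≤ d) :
    1 ≤ srwPotential (0 : Fin d → ℤ) := by
  have := (summable_srwKernel hd (0 : Fin d → ℤ)).le_tsum 0 fun k _ => srwKernel_nonneg k _
  simpa [srwKernel, srwPotential] using this

/-- The Green function is harmonic away from the origin. -/
theorem sum_srwPotential_srwStep {d : ℕ} (hd : 4 ≤ d) (x : Fin d → ℤ) :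
    ∑ s : Fin d × Bool, srwPotential (x + srwStep s) =
      2 * d * (srwPotential x - if x = 0 then 1 else 0) := by
  have hd' : (2 * d : ℝ) ≠ 0 := by positivity
  have h1 := (summable_srwKernel hd x).tsum_eq_zero_add
  have h2 : ∑' k, srwKernel (k + 1) x =
      (∑ s : Fin d × Bool, srwPotential (x + srwStep s)) / (2 * d) := by
    simp only [srwKernel, srwPotential]
    rw [tsum_div_const, Summable.tsum_finsetSum fun s _ => summable_srwKernel hd _]
  rw [srwPotential, h1, h2]
  simp only [srwKernel]
  field_simp; ring

/-- `G(x, Λ) ≤ C |Λ|^{2/d}`. -/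
theorem exists_sum_srwPotential_le {d : ℕ} (hd : 4 ≤ d) :
    ∃ C : ℝ, 0 < C ∧ ∀ (Λ : Finset (Fin d → ℤ)) (x : Fin d → ℤ),
      ∑ y ∈ Λ, srwPotential (x - y) ≤ C * (Λ.card : ℝ) ^ (2 / (d : ℝ)) := by
  have hd0 : (0 : ℝ) < d := by positivity
  obtain ⟨C, hC, h⟩ := exists_srwKernel_le (d := d) (by omega)
  refine ⟨2 + 2 * C ^ d, by positivity, fun Λ x => ?_⟩
  rcases Λ.eq_empty_or_nonempty with rfl | hΛ
  · simp; positivity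
  set N : ℝ := (Λ.card : ℝ) with hN
  have hN1 : 1 ≤ N := by rw [hN]; exact_mod_cast hΛ.card_pos
  -- The diffusive time scale of a ball with `N` sites: up to time `R` the walk's total mass 1 is
  -- the better bound, after it the heat kernel bound times `N`.
  set R : ℝ := N ^ (2 / (d : ℝ)) with hR
  have hR1 : 1 ≤ R := Real.one_le_rpow hN1 (by positivity)
  have hNR : N = √R ^ d := by
    rw [hR, Real.sqrt_eq_rpow, ← Real.rpow_natCast, ← Real.rpow_mul (by positivity),
      ← Real.rpow_mul (by positivity)]
    rw [show 2 / (d : ℝ) * (1 / 2 * d) = 1 by field_simp, Real.rpow_one]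
  clear_value R
  clear hR
  have hR0 : 0 < R := by linarith
  have hbig : ∀ k : ℕ, R ≤ k → ∑ y ∈ Λ, srwKernel k (x - y) ≤ C ^ d * R ^ 2 * ((k : ℝ) ^ 2)⁻¹ := by
    intro k hk
    have hk0 : (0 : ℝ) < k := by linarith
    have hk0' : 0 < k := by exact_mod_cast hk0
    calc ∑ y ∈ Λ, srwKernel k (x - y) ≤ ∑ _y ∈ Λ, (C / √k) ^ d :=
          Finset.sum_le_sum fun y _ => h k hk0' _
      _ = C ^ d * (√R / √k) ^ d := by
          rw [Finset.sum_const, nsmul_eq_mul, ← hN, hNR, div_pow, div_pow]; ring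
      _ ≤ C ^ d * (√R / √k) ^ 4 := by
          gcongr C ^ d * ?_
          refine pow_le_pow_of_le_one (by positivity) ?_ hd
          exact div_le_one_of_le₀ (Real.sqrt_le_sqrt hk) (Real.sqrt_nonneg _)
      _ = C ^ d * R ^ 2 * ((k : ℝ) ^ 2)⁻¹ := by
          rw [show 4 = 2 * 2 from rfl, pow_mul, div_pow, Real.sq_sqrt hk0.le,
            Real.sq_sqrt (by linarith), div_pow]; ring
  have hsum : ∑ y ∈ Λ, srwPotential (x - y) = ∑' k, ∑ y ∈ Λ, srwKernel k (x - y) := by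
    simp only [srwPotential]
    rw [Summable.tsum_finsetSum fun s _ => summable_srwKernel hd _]
  rw [hsum]
  refine Real.tsum_le_of_sum_range_le
    (fun k => Finset.sum_nonneg fun y _ => srwKernel_nonneg k _) fun n => ?_
  set m := ⌊R⌋₊ with hm
  have hRm : R < m + 1 := Nat.lt_floor_add_one R
  have hmR : (m : ℝ) ≤ R := Nat.floor_le (by linarith)
  calc ∑ k ∈ Finset.range n, ∑ y ∈ Λ, srwKernel k (x - y)
      ≤ ∑ k ∈ Finset.range (m + 1) ∪ Finset.Ioo m n, ∑ y ∈ Λ, srwKernel k (x - y) := by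
        refine Finset.sum_le_sum_of_subset_of_nonneg ?_
          fun k _ _ => Finset.sum_nonneg fun y _ => srwKernel_nonneg k _
        intro k hk
        simp only [Finset.mem_union, Finset.mem_range, Finset.mem_Ioo] at *
        omega
    _ ≤ ∑ k ∈ Finset.range (m + 1), ∑ y ∈ Λ, srwKernel k (x - y) +
          ∑ k ∈ Finset.Ioo m n, ∑ y ∈ Λ, srwKernel k (x - y) := by
        rw [← Finset.sum_union_inter]
        exact le_add_of_nonneg_right
          (Finset.sum_nonneg fun k _ => Finset.sum_nonneg fun y _ => srwKernel_nonneg k _)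
    _ ≤ ∑ _k ∈ Finset.range (m + 1), (1 : ℝ) +
          ∑ k ∈ Finset.Ioo m n, C ^ d * R ^ 2 * ((k : ℝ) ^ 2)⁻¹ := by
        refine add_le_add
          (Finset.sum_le_sum fun k _ => sum_srwKernel_sub_le_one (by omega) k Λ x)
          (Finset.sum_le_sum fun k hk => hbig k ?_)
        have : m + 1 ≤ k := (Finset.mem_Ioo.mp hk).1
        have : ((m + 1 : ℕ) : ℝ) ≤ k := by exact_mod_cast this
        push_cast at this; linarith
    _ ≤ (m + 1) + C ^ d * R ^ 2 * (2 / (m + 1)) := by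
        rw [← Finset.mul_sum]
        gcongr
        · simp
        · exact sum_Ioo_inv_sq_le m n
    _ ≤ 2 * R + C ^ d * R ^ 2 * (2 / R) := by
        gcongr
        linarith
    _ = (2 + 2 * C ^ d) * R := by field_simp

/-- Every finite set `Λ` contains a subset of size of order `|Λ|^{1-2/d}` on which the Green
potential of the subset is bounded. -/
theorem exists_subset_potential_le {d : ℕ} (hd : 4 ≤ d) :
    ∃ c K : ℝ, 0 < c ∧ 0 < K ∧ ∀ (Λ : Finset (Fin d → ℤ)) (k : ℕ),
      (k : ℝ) ≤ c * (Λ.card : ℝ) ^ (1 - 2 / (d : ℝ)) →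
      ∃ U ⊆ Λ, U.card = k ∧ ∀ x ∈ U, ∑ y ∈ U, srwPotential (x - y) ≤ K := by
  classical
  obtain ⟨C, hC, h⟩ := exists_sum_srwPotential_le hd
  have hd0 : 0 < d := by omega
  set G0 := srwPotential (0 : Fin d → ℤ) with hG0
  have hG1 : 1 ≤ G0 := one_le_srwPotential_zero hd
  -- With `1 / (4 * C)`, the potential of any set of at most `2k` sites has average at most 1/2 over
  -- `Λ`; `2 * (G0 + 1)` is twice the energy per site in the greedy construction.
  refine ⟨1 / (4 * C), 2 * (G0 + 1), by positivity, by positivity, fun Λ k hk => ?_⟩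
  rcases Nat.eq_zero_or_pos k with rfl | hk0
  · exact ⟨∅, by simp, by simp, by simp⟩
  have hk0' : (0 : ℝ) < k := by exact_mod_cast hk0
  rcases Λ.eq_empty_or_nonempty with rfl | hΛ
  · have h1 : (1 - 2 / (d : ℝ)) ≠ 0 := by
      have : (4 : ℝ) ≤ d := by exact_mod_cast hd
      have : 2 / (d : ℝ) ≤ 2 / 4 := by gcongr
      intro h0; linarith
    rw [Finset.card_empty, Nat.cast_zero, Real.zero_rpow h1, mul_zero] at hk
    linarith
  have hN : (0 : ℝ) < Λ.card := by exact_mod_cast hΛ.card_pos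
  have hbudget : (2 * k : ℝ) * (C * (Λ.card : ℝ) ^ (2 / (d : ℝ))) ≤ Λ.card * (1 / 2) := by
    calc (2 * k : ℝ) * (C * (Λ.card : ℝ) ^ (2 / (d : ℝ)))
        ≤ (2 * (1 / (4 * C) * (Λ.card : ℝ) ^ (1 - 2 / (d : ℝ)))) *
            (C * (Λ.card : ℝ) ^ (2 / (d : ℝ))) := by gcongr
      _ = ((Λ.card : ℝ) ^ (1 - 2 / (d : ℝ)) * (Λ.card : ℝ) ^ (2 / (d : ℝ))) * (1 / 2) := by
          field_simp; norm_num
      _ = _ := by rw [← Real.rpow_add hN]; simp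
  -- Each new site adds its self-energy `G0` and twice an interaction of at most 1/2.
  have greedy : ∀ j : ℕ, j ≤ 2 * k → ∃ V ⊆ Λ, V.card = j ∧
      ∑ x ∈ V, ∑ y ∈ V, srwPotential (x - y) ≤ j * (G0 + 1) := by
    intro j
    induction j with
    | zero => exact fun _ => ⟨∅, by simp, by simp, by simp⟩
    | succ j ih =>
      intro hj
      obtain ⟨V, hV, hVc, hVe⟩ := ih (by omega)
      have hex : ∃ x ∈ Λ, ∑ y ∈ V, srwPotential (x - y) ≤ 1 / 2 := by
        by_contra! hcon
        have h1 : (Λ.card : ℝ) * (1 / 2) < ∑ x ∈ Λ, ∑ y ∈ V, srwPotential (x - y) := by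
          calc (Λ.card : ℝ) * (1 / 2) = ∑ _x ∈ Λ, (1 / 2 : ℝ) := by simp
            _ < _ := Finset.sum_lt_sum_of_nonempty hΛ hcon
        have h2 : ∑ x ∈ Λ, ∑ y ∈ V, srwPotential (x - y) ≤
            (2 * k : ℝ) * (C * (Λ.card : ℝ) ^ (2 / (d : ℝ))) := by
          rw [Finset.sum_comm]
          calc ∑ y ∈ V, ∑ x ∈ Λ, srwPotential (x - y)
              = ∑ y ∈ V, ∑ x ∈ Λ, srwPotential (y - x) := by
                refine Finset.sum_congr rfl fun y _ => Finset.sum_congr rfl fun x _ => ?_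
                rw [← srwPotential_neg hd0, neg_sub]
            _ ≤ ∑ _y ∈ V, C * (Λ.card : ℝ) ^ (2 / (d : ℝ)) :=
                Finset.sum_le_sum fun y _ => h Λ y
            _ = (j : ℝ) * (C * (Λ.card : ℝ) ^ (2 / (d : ℝ))) := by simp [hVc]
            _ ≤ _ := by
                have : (j : ℝ) ≤ 2 * k := by exact_mod_cast (by omega : j ≤ 2 * k)
                gcongr
        linarith
      obtain ⟨x, hx, hxV⟩ := hex
      -- At a site of `V` the potential is at least `G0 ≥ 1`, above the threshold 1/2.
      have hxn : x ∉ V := by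
        intro hxm
        have := Finset.single_le_sum (f := fun y => srwPotential (x - y))
          (fun y _ => srwPotential_nonneg _) hxm
        simp only [sub_self] at this
        linarith
      refine ⟨insert x V, Finset.insert_subset hx hV, by rw [Finset.card_insert_of_notMem hxn, hVc],
        ?_⟩
      rw [Finset.sum_insert hxn, Finset.sum_insert hxn]
      have h3 : ∑ z ∈ V, ∑ y ∈ insert x V, srwPotential (z - y) =
          ∑ y ∈ V, srwPotential (x - y) + ∑ z ∈ V, ∑ y ∈ V, srwPotential (z - y) := by
        rw [← Finset.sum_add_distrib]
        refine Finset.sum_congr rfl fun z _ => ?_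
        rw [Finset.sum_insert hxn, ← srwPotential_neg hd0, neg_sub]
      rw [h3, sub_self]
      push_cast
      linarith
  obtain ⟨V, hV, hVc, hVe⟩ := greedy (2 * k) le_rfl
  -- By Markov's inequality at least half of the `2k` sites have potential at most twice the mean
  -- bound; passing to a subset only lowers potentials.
  set W := V.filter fun x => ∑ y ∈ V, srwPotential (x - y) ≤ 2 * (G0 + 1) with hW
  have hWk : k ≤ W.card := by
    by_contra! hlt
    have hsplit := Finset.card_filter_add_card_filter_not (s := V)
      (fun x => ∑ y ∈ V, srwPotential (x - y) ≤ 2 * (G0 + 1))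
    rw [← hW, hVc] at hsplit
    set W' := V.filter fun x => ¬ ∑ y ∈ V, srwPotential (x - y) ≤ 2 * (G0 + 1) with hW'
    have hW'k : (k : ℝ) + 1 ≤ W'.card := by exact_mod_cast (by omega : k + 1 ≤ W'.card)
    have h1 : (W'.card : ℝ) * (2 * (G0 + 1)) ≤ ∑ x ∈ V, ∑ y ∈ V, srwPotential (x - y) := by
      calc (W'.card : ℝ) * (2 * (G0 + 1)) = ∑ _x ∈ W', 2 * (G0 + 1) := by simp
        _ ≤ ∑ x ∈ W', ∑ y ∈ V, srwPotential (x - y) := by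
            refine Finset.sum_le_sum fun x hx => ?_
            exact (not_le.mp (Finset.mem_filter.mp hx).2).le
        _ ≤ _ := Finset.sum_le_sum_of_subset_of_nonneg (Finset.filter_subset _ _)
            fun x _ _ => Finset.sum_nonneg fun y _ => srwPotential_nonneg _
    push_cast at hVe
    nlinarith
  obtain ⟨U, hU, hUc⟩ := Finset.exists_subset_card_eq hWk
  refine ⟨U, hU.trans ((Finset.filter_subset _ _).trans hV), hUc, fun x hx => ?_⟩
  refine le_trans ?_ (Finset.mem_filter.mp (hU hx)).2
  exact Finset.sum_le_sum_of_subset_of_nonneg (hU.trans (Finset.filter_subset _ _))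
    fun y _ _ => srwPotential_nonneg _

/-! ### Independence of steps and the Feynman-Kac bound -/

theorem srwLaw_coord_eq {d : ℕ} [NeZero d] (k : ℕ) (s : Fin d × Bool) :
    srwLaw d {ω | ω k = s} = (2 * d : ℝ≥0∞)⁻¹ := by
  have h := Measure.infinitePi_map_eval
    (fun _ : ℕ => uniformOn (Set.univ : Set (Fin d × Bool))) k
  have h2 := DFunLike.congr_fun h {s}
  rw [Measure.map_apply (measurable_pi_apply k) (measurableSet_singleton s)] at h2
  have : {ω : ℕ → Fin d × Bool | ω k = s} = (fun x : ℕ → Fin d × Bool => x k) ⁻¹' {s} := rfl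
  rw [this, srwLaw, h2, uniformOn_univ]
  simp [mul_comm]

/-- A function of the first `k` steps is measurable. -/
theorem measurable_of_prefix {A β : Type*} [Nonempty A] [Finite A] [MeasurableSpace A]
    [MeasurableSingletonClass A] [MeasurableSpace β] {k : ℕ} {f : (ℕ → A) → β}
    (hf : ∀ ω ω' : ℕ → A, (∀ i < k, ω i = ω' i) → f ω = f ω') :
    ∃ g : (Finset.range k → A) → β, Measurable g ∧
      f = fun ω => g fun i => ω i := by
  classical
  refine ⟨fun v => f fun i => if h : i ∈ Finset.range k then v ⟨i, h⟩ else Classical.arbitrary A,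
    Measurable.of_discrete, funext fun ω => hf _ _ fun i hi => ?_⟩
  rw [dif_pos (Finset.mem_range.mpr hi)]

/-- Averaging over the step at time `k`, given the previous ones. -/
theorem lintegral_srwLaw_step {d : ℕ} [NeZero d] (k : ℕ)
    (H : (ℕ → Fin d × Bool) → Fin d × Bool → ℝ≥0∞)
    (hH : ∀ ω ω' : ℕ → Fin d × Bool, (∀ i < k, ω i = ω' i) → H ω = H ω') :
    ∫⁻ ω, H ω (ω k) ∂(srwLaw d) = ∫⁻ ω, (∑ s, H ω s) / (2 * d) ∂(srwLaw d) := by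
  classical
  have hind : iIndepFun (fun (i : ℕ) (ω : ℕ → Fin d × Bool) => ω i) (srwLaw d) :=
    iIndepFun_infinitePi (X := fun _ s => s) fun _ => measurable_id
  have hind2 := hind.indepFun_finset (Finset.range k) {k} (by simp)
    fun i => measurable_pi_apply i
  have hm : ∀ s, Measurable fun ω => H ω s := by
    intro s
    obtain ⟨g, hg, e⟩ := measurable_of_prefix (f := fun ω => H ω s)
      fun ω ω' h => congrFun (hH ω ω' h) s
    rw [e]
    exact hg.comp (measurable_pi_lambda _ fun i => measurable_pi_apply _)
  have hmi : ∀ s : Fin d × Bool, Measurable fun ω : ℕ → Fin d × Bool =>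
      if ω k = s then (1 : ℝ≥0∞) else 0 := fun s =>
    (Measurable.of_discrete (f := fun a : Fin d × Bool => if a = s then (1 : ℝ≥0∞) else 0)).comp
      (measurable_pi_apply k)
  -- Splitting by the value of the step leaves products of a function of the past and an independent
  -- indicator.
  have hsplit : ∀ ω : ℕ → Fin d × Bool,
      H ω (ω k) = ∑ s, H ω s * (if ω k = s then 1 else 0) := by
    intro ω; simp
  have hone : ∀ s : Fin d × Bool,
      ∫⁻ ω : ℕ → Fin d × Bool, (if ω k = s then (1 : ℝ≥0∞) else 0) ∂(srwLaw d) =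
        (2 * d : ℝ≥0∞)⁻¹ := by
    intro s
    have hs : MeasurableSet {ω : ℕ → Fin d × Bool | ω k = s} :=
      (measurable_pi_apply (X := fun _ : ℕ => Fin d × Bool) k) (measurableSet_singleton s)
    rw [← srwLaw_coord_eq k s, ← lintegral_indicator_one hs]
    exact lintegral_congr fun ω => by simp [Set.indicator_apply]
  simp_rw [hsplit, div_eq_mul_inv, Finset.sum_mul]
  rw [lintegral_finsetSum _ fun s _ => by exact (hm s).mul (hmi s),
    lintegral_finsetSum _ fun s _ => (hm s).mul_const _]
  refine Finset.sum_congr rfl fun s _ => ?_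
  rw [lintegral_mul_const _ (hm s), ← hone s]
  obtain ⟨g, hg, e⟩ := measurable_of_prefix (f := fun ω => H ω s)
    fun ω ω' h => congrFun (hH ω ω' h) s
  refine lintegral_mul_eq_lintegral_mul_lintegral_of_indepFun (hm s) (hmi s) ?_
  rw [e]
  exact hind2.comp hg (Measurable.of_discrete (f := fun v : ({k} : Finset ℕ) → Fin d × Bool =>
    if v ⟨k, by simp⟩ = s then (1 : ℝ≥0∞) else 0))

theorem srwPos_congr {d k : ℕ} {ω ω' : ℕ → Fin d × Bool} (h : ∀ i < k, ω i = ω' i) :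
    srwPos k ω = srwPos k ω' :=
  Finset.sum_congr rfl fun i hi => by rw [h i (Finset.mem_range.mp hi)]

theorem measurable_srwPos {d : ℕ} [NeZero d] (k : ℕ) :
    Measurable (srwPos k : (ℕ → Fin d × Bool) → Fin d → ℤ) := by
  obtain ⟨g, hg, e⟩ := measurable_of_prefix (A := Fin d × Bool) (f := srwPos k)
    fun ω ω' h => srwPos_congr h
  rw [e]
  exact hg.comp (measurable_pi_lambda _ fun i => measurable_pi_apply _)

/-- The Feynman-Kac supermartingale bound: `h` with `V · P h ≤ h` bounds the expected product of
the weights `V` along the walk. -/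
theorem lintegral_prod_weight_le {d : ℕ} [NeZero d] (V h : (Fin d → ℤ) → ℝ≥0∞)
    (hVh : ∀ x, V x * ((∑ s : Fin d × Bool, h (x + srwStep s)) / (2 * d)) ≤ h x) (n : ℕ) :
    ∫⁻ ω, (∏ k ∈ Finset.range n, V (srwPos k ω)) * h (srwPos n ω) ∂(srwLaw d) ≤ h 0 := by
  induction n with
  | zero => simp [srwPos]
  | succ n ih =>
    refine le_trans ?_ ih
    have e : ∀ ω : ℕ → Fin d × Bool, srwPos (n + 1) ω = srwPos n ω + srwStep (ω n) :=
      fun ω => Finset.sum_range_succ _ _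
    simp_rw [e]
    rw [lintegral_srwLaw_step n fun ω s =>
      (∏ k ∈ Finset.range (n + 1), V (srwPos k ω)) * h (srwPos n ω + srwStep s)]
    · refine lintegral_mono fun ω => ?_
      dsimp only
      rw [← Finset.mul_sum, Finset.prod_range_succ, mul_assoc, mul_div_assoc, mul_div_assoc]
      gcongr
      exact hVh _
    · intro ω ω' hω
      have h1 : ∀ k ≤ n, srwPos k ω = srwPos k ω' := fun k hk =>
        srwPos_congr fun i hi => hω i (by omega)
      funext s
      rw [h1 n le_rfl]
      congr 1
      exact Finset.prod_congr rfl fun k hk => by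
        rw [h1 k (Nat.lt_succ_iff.mp (Finset.mem_range.mp hk))]

theorem prod_range_srwPos_mem {d : ℕ} (U : Finset (Fin d → ℤ)) (q : ℝ≥0∞) (n : ℕ)
    (ω : ℕ → Fin d × Bool) :
    ∏ k ∈ Finset.range (n + 1), (if srwPos k ω ∈ U then q else 1) =
      q ^ (∑ x ∈ U, srwLocalTime n x ω) := by
  classical
  rw [Finset.prod_ite, Finset.prod_const, Finset.prod_const_one, mul_one]
  congr 1
  rw [Finset.card_eq_sum_card_fiberwise (f := fun k => srwPos k ω)
    (s := (Finset.range (n + 1)).filter fun k => srwPos k ω ∈ U) (t := U)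
    (fun k hk => (Finset.mem_filter.mp hk).2)]
  refine Finset.sum_congr rfl fun x hx => ?_
  rw [srwLocalTime, Finset.filter_filter]
  congr 1
  refine Finset.filter_congr fun k _ => ?_
  constructor
  · exact fun h => h.2
  · exact fun h => ⟨h ▸ hx, h⟩

/-! ### Exponential moments of occupation times -/

theorem exists_srwPotential_le {d : ℕ} (hd : 4 ≤ d) :
    ∃ C : ℝ, 0 < C ∧ ∀ x : Fin d → ℤ, srwPotential x ≤ C := by
  obtain ⟨C, hC, h⟩ := exists_sum_srwPotential_le hd
  exact ⟨C, hC, fun x => by simpa using h {0} x⟩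

/-- Exponential moments of the total occupation of a set on which the Green potential is
bounded. -/
theorem lintegral_pow_localTime_le {d : ℕ} (hd : 4 ≤ d) {K : ℝ} (hK : 0 < K)
    (U : Finset (Fin d → ℤ)) (hU : ∀ x ∈ U, ∑ y ∈ U, srwPotential (x - y) ≤ K) (n : ℕ) :
    ∫⁻ ω, ENNReal.ofReal (1 + 1 / (2 * K)) ^ (∑ x ∈ U, srwLocalTime n x ω) ∂(srwLaw d) ≤
      ENNReal.ofReal (1 + (∑ y ∈ U, srwPotential (0 - y)) / K) := by
  classical
  have : NeZero d := ⟨by omega⟩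
  have hd0 : (0 : ℝ) < d := by positivity
  set g : (Fin d → ℤ) → ℝ := fun x => ∑ y ∈ U, srwPotential (x - y) with hg
  have hg0 : ∀ x, 0 ≤ g x := fun x => Finset.sum_nonneg fun y _ => srwPotential_nonneg _
  -- For `h = 1 + g/K`, one step of the walk lowers `h` by exactly `1/K` on `U` and leaves it
  -- unchanged elsewhere.
  have hharm : ∀ x, (∑ s : Fin d × Bool, (1 + g (x + srwStep s) / K)) / (2 * d) =
      1 + (g x - if x ∈ U then 1 else 0) / K := by
    intro x
    have h1 : ∑ s : Fin d × Bool, g (x + srwStep s) =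
        2 * d * (g x - if x ∈ U then 1 else 0) := by
      simp only [hg]
      rw [Finset.sum_comm]
      simp_rw [add_sub_right_comm, sum_srwPotential_srwStep hd, sub_eq_zero]
      rw [← Finset.mul_sum, Finset.sum_sub_distrib, Finset.sum_ite_eq]
    rw [Finset.sum_add_distrib, ← Finset.sum_div, h1]
    simp only [Finset.sum_const, Finset.card_univ, Fintype.card_prod, Fintype.card_fin,
      Fintype.card_bool, nsmul_eq_mul, mul_one]
    push_cast
    field_simp
  -- Taken at `n + 1`, since the local time counts the times `0, …, n`.
  have key := lintegral_prod_weight_le (d := d)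
    (fun x => if x ∈ U then ENNReal.ofReal (1 + 1 / (2 * K)) else 1)
    (fun x => ENNReal.ofReal (1 + g x / K)) ?_ (n + 1)
  · refine le_trans (lintegral_mono fun ω => ?_) key
    dsimp only
    rw [prod_range_srwPos_mem]
    refine le_mul_of_one_le_right zero_le ?_
    rw [ENNReal.one_le_ofReal]
    have := hg0 (srwPos (n + 1) ω)
    have : 0 ≤ g (srwPos (n + 1) ω) / K := by positivity
    linarith
  · intro x
    have hpos : ∀ z, 0 ≤ 1 + g z / K := fun z => by have := hg0 z; positivity
    have e2 : (2 * d : ℝ≥0∞) = ENNReal.ofReal (2 * d) := by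
      rw [ENNReal.ofReal_mul (by norm_num)]; simp
    rw [← ENNReal.ofReal_sum_of_nonneg fun s _ => hpos _, e2,
      ← ENNReal.ofReal_div_of_pos (by positivity), hharm]
    split_ifs with hx
    · rw [← ENNReal.ofReal_mul (by positivity)]
      apply ENNReal.ofReal_le_ofReal
      have hgK : g x ≤ K := hU x hx
      have : g x / K ≤ 1 := (div_le_one hK).mpr hgK
      have h3 : (1 + 1 / (2 * K)) * (1 + (g x - 1) / K) =
          1 + g x / K - (1 / (2 * K)) * (1 - g x / K) - 1 / (2 * K) * (1 / K) := by
        field_simp; ring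
      rw [h3]
      have h4 : 0 ≤ (1 / (2 * K)) * (1 - g x / K) :=
        mul_nonneg (by positivity) (by linarith)
      have h5 : 0 ≤ 1 / (2 * K) * (1 / K) := by positivity
      linarith
    · simp

/-- Chernoff's bound from the exponential moment. -/
theorem srwLaw_localTime_ge_le {d : ℕ} (hd : 4 ≤ d) {K : ℝ} (hK : 0 < K)
    (U : Finset (Fin d → ℤ)) (hU : ∀ x ∈ U, ∑ y ∈ U, srwPotential (x - y) ≤ K) (n : ℕ) (t : ℝ) :
    (srwLaw d).real {ω | t ≤ ((∑ x ∈ U, srwLocalTime n x ω : ℕ) : ℝ)} ≤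
      (1 + (∑ y ∈ U, srwPotential (0 - y)) / K) *
        Real.exp (-(Real.log (1 + 1 / (2 * K)) * t)) := by
  have : NeZero d := ⟨by omega⟩
  set q : ℝ := 1 + 1 / (2 * K) with hq
  have hq0 : 1 < q := by rw [hq]; have : 0 < 1 / (2 * K) := by positivity
                         linarith
  have hl : 0 < Real.log q := Real.log_pos hq0
  have hmom := lintegral_pow_localTime_le hd hK U hU n
  rw [← hq] at hmom
  have hmeas : Measurable fun ω : ℕ → Fin d × Bool =>
      ENNReal.ofReal q ^ (∑ x ∈ U, srwLocalTime n x ω) := by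
    simp_rw [← prod_range_srwPos_mem]
    exact Finset.measurable_fun_prod _ fun k _ =>
      (Measurable.of_discrete (f := fun x => if x ∈ U then ENNReal.ofReal q else 1)).comp
        (measurable_srwPos k)
  have hE : 0 < Real.exp (Real.log q * t) := Real.exp_pos _
  have hsub : {ω : ℕ → Fin d × Bool | t ≤ ((∑ x ∈ U, srwLocalTime n x ω : ℕ) : ℝ)} ⊆
      {ω | ENNReal.ofReal (Real.exp (Real.log q * t)) ≤
        ENNReal.ofReal q ^ (∑ x ∈ U, srwLocalTime n x ω)} := by
    intro ω hω
    simp only [Set.mem_ofPred_eq] at *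
    rw [← ENNReal.ofReal_pow (by linarith)]
    apply ENNReal.ofReal_le_ofReal
    rw [← Real.rpow_natCast, Real.rpow_def_of_pos (by linarith)]
    exact Real.exp_le_exp.mpr (by gcongr)
  have hM := mul_meas_ge_le_lintegral (μ := srwLaw d) hmeas
    (ENNReal.ofReal (Real.exp (Real.log q * t)))
  have h1 : ENNReal.ofReal (Real.exp (Real.log q * t)) *
      srwLaw d {ω | t ≤ ((∑ x ∈ U, srwLocalTime n x ω : ℕ) : ℝ)} ≤
      ENNReal.ofReal (1 + (∑ y ∈ U, srwPotential (0 - y)) / K) :=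
    (mul_le_mul_right (measure_mono hsub) _).trans (hM.trans hmom)
  have hS : 0 ≤ ∑ y ∈ U, srwPotential (0 - y) :=
    Finset.sum_nonneg fun y _ => srwPotential_nonneg _
  have h2 := ENNReal.toReal_mono ENNReal.ofReal_ne_top h1
  rw [ENNReal.toReal_mul, ENNReal.toReal_ofReal hE.le,
    ENNReal.toReal_ofReal (by positivity)] at h2
  rw [Real.exp_neg, ← div_eq_mul_inv, le_div_iff₀ hE, mul_comm]
  exact h2

/-! ### Union bound over sparse subsets, and the conclusion -/

theorem abs_srwStep_le_one {d : ℕ} (s : Fin d × Bool) (i : Fin d) : |srwStep s i| ≤ 1 := by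
  unfold srwStep
  by_cases h : i = s.1
  · subst h; split_ifs <;> simp
  · simp [Pi.single_eq_of_ne h]

theorem abs_srwPos_le {d : ℕ} (k : ℕ) (ω : ℕ → Fin d × Bool) (i : Fin d) :
    |srwPos k ω i| ≤ k := by
  rw [srwPos, Finset.sum_apply]
  calc |∑ j ∈ Finset.range k, srwStep (ω j) i|
      ≤ ∑ j ∈ Finset.range k, |srwStep (ω j) i| := Finset.abs_sum_le_sum_abs _ _
    _ ≤ ∑ _j ∈ Finset.range k, (1 : ℤ) :=
        Finset.sum_le_sum fun j _ => abs_srwStep_le_one _ _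
    _ = k := by simp

/-- Confines the candidate sites to polynomially many in `n`. -/
theorem srwLevelSet_subset_box {d n : ℕ} (hn : 1 ≤ n) (b a : ℝ) (ω : ℕ → Fin d × Bool) :
    srwLevelSet n b a ω ⊆ ↑(Finset.Icc (fun _ : Fin d => -(n : ℤ)) (fun _ => (n : ℤ))) := by
  intro x hx
  have h0 : (0 : ℝ) < (n : ℝ) ^ b := Real.rpow_pos_of_pos (by exact_mod_cast hn) b
  have h1 : 0 < srwLocalTime n x ω := by exact_mod_cast h0.trans_le hx.1
  obtain ⟨k, hk⟩ := Finset.card_pos.mp h1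
  obtain ⟨hkn, rfl⟩ := Finset.mem_filter.mp hk
  have hkn' : (k : ℤ) ≤ n := by
    exact_mod_cast Nat.lt_succ_iff.mp (Finset.mem_range.mp hkn)
  have h2 : ∀ i, |srwPos k ω i| ≤ n := fun i => (abs_srwPos_le k ω i).trans hkn'
  rw [Finset.mem_coe, Finset.mem_Icc]
  exact ⟨fun i => (abs_le.mp (h2 i)).1, fun i => (abs_le.mp (h2 i)).2⟩

theorem card_box (d n : ℕ) :
    (Finset.Icc (fun _ : Fin d => -(n : ℤ)) (fun _ => (n : ℤ))).card = (2 * n + 1) ^ d := by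
  rw [Pi.card_Icc]
  simp only [Int.card_Icc, Finset.prod_const, Finset.card_univ, Fintype.card_fin]
  congr 1
  omega

/-- Upper tail of the size of a level set of the local times: no condition relating the exponents
is needed, because it suffices to look at a subset of bounded Green potential. -/
theorem exists_srwLaw_levelSet_le {d : ℕ} (hd : 4 ≤ d) :
    ∃ κ : ℝ, 0 < κ ∧ ∀ b γ a y : ℝ, 0 < b → 0 < γ → 0 < y →
      ∀ᶠ n : ℕ in atTop,
        (srwLaw d).real {ω | (n : ℝ) ^ γ * y < ((srwLevelSet n b a ω).ncard : ℝ)} ≤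
          Real.exp (-(κ * y ^ (1 - 2 / (d : ℝ)) * (n : ℝ) ^ ((1 - 2 / (d : ℝ)) * γ + b))) := by
  classical
  have : NeZero d := ⟨by omega⟩
  obtain ⟨c, K, hc, hK, hsub⟩ := exists_subset_potential_le hd
  obtain ⟨C, hC, hpot⟩ := exists_srwPotential_le hd
  set l := Real.log (1 + 1 / (2 * K)) with hl
  have hl0 : 0 < l := Real.log_pos (by have : 0 < 1 / (2 * K) := by positivity
                                       linarith)
  have hα : 0 < 1 - 2 / (d : ℝ) := by
    have : (4 : ℝ) ≤ d := by exact_mod_cast hd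
    have : 2 / (d : ℝ) ≤ 2 / 4 := by gcongr
    linarith
  set α := 1 - 2 / (d : ℝ) with hαd
  -- One factor 1/2 pays for the union bound, the other for rounding `k` down.
  refine ⟨c * l / 4, by positivity, fun b γ a y hb hγ hy => ?_⟩
  have hcast : Tendsto (fun n : ℕ => (n : ℝ)) atTop atTop := tendsto_natCast_atTop_atTop
  have ev1 : ∀ᶠ n : ℕ in atTop, 1 ≤ c * ((n : ℝ) ^ γ * y) ^ α := by
    have : Tendsto (fun n : ℕ => c * ((n : ℝ) ^ γ * y) ^ α) atTop atTop :=
      (((tendsto_rpow_atTop hα).comp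
        (((tendsto_rpow_atTop hγ).comp hcast).atTop_mul_const hy))).const_mul_atTop hc
    exact this.eventually_ge_atTop 1
  -- Per site of `U`: the entropy of its position and the share of `h(0)` cost at most half of the
  -- gain `l * n ^ b`.
  have ev2 : ∀ᶠ n : ℕ in atTop, d * Real.log (2 * n + 1) + C / K ≤ l / 2 * (n : ℝ) ^ b := by
    have hε : 0 < l / (4 * d) := by positivity
    have h1 := (isLittleO_log_rpow_atTop hb).bound hε
    have h2 : ∀ᶠ n : ℕ in atTop, d * Real.log 3 + C / K ≤ l / 4 * (n : ℝ) ^ b :=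
      (((tendsto_rpow_atTop hb).comp hcast).const_mul_atTop
        (by positivity : 0 < l / 4)).eventually_ge_atTop _
    filter_upwards [hcast.eventually h1, h2, eventually_ge_atTop 1] with n h3 h4 h5
    have hn : (1 : ℝ) ≤ n := by exact_mod_cast h5
    have h6 : Real.log (2 * n + 1) ≤ Real.log 3 + Real.log n := by
      rw [← Real.log_mul (by norm_num) (by positivity)]
      exact Real.log_le_log (by positivity) (by linarith)
    rw [Real.norm_of_nonneg (Real.log_nonneg hn), Real.norm_of_nonneg (by positivity)] at h3
    have hd0 : (0 : ℝ) < d := by positivity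
    have h7 : d * Real.log n ≤ l / 4 * (n : ℝ) ^ b := by
      calc d * Real.log n ≤ d * (l / (4 * d) * (n : ℝ) ^ b) := by gcongr
        _ = _ := by field_simp
    have h8 : d * Real.log (2 * n + 1) ≤ d * Real.log 3 + d * Real.log n := by
      rw [← mul_add]; gcongr
    linarith
  filter_upwards [ev1, ev2, eventually_ge_atTop 1] with n h1 h2 hn
  have hn0 : (0 : ℝ) < n := by exact_mod_cast hn
  set X := ((n : ℝ) ^ γ * y) ^ α with hX
  set k := ⌊c * X⌋₊ with hk
  have hX0 : 0 < X := by positivity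
  have hkle : (k : ℝ) ≤ c * X := Nat.floor_le (by positivity)
  have hkge : c * X / 2 ≤ k := by
    have h3 := Nat.lt_floor_add_one (c * X)
    have h4 : (1 : ℝ) ≤ k := by exact_mod_cast (Nat.one_le_floor_iff _).mpr h1
    rw [← hk] at h3
    linarith
  set box := Finset.Icc (fun _ : Fin d => -(n : ℤ)) (fun _ => (n : ℤ)) with hbox
  set 𝒰 := (box.powersetCard k).filter
    fun U => ∀ x ∈ U, ∑ y ∈ U, srwPotential (x - y) ≤ K with h𝒰
  have hcover : {ω : ℕ → Fin d × Bool | (n : ℝ) ^ γ * y < ((srwLevelSet n b a ω).ncard : ℝ)} ⊆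
      ⋃ U ∈ 𝒰, {ω | (k : ℝ) * (n : ℝ) ^ b ≤ ((∑ x ∈ U, srwLocalTime n x ω : ℕ) : ℝ)} := by
    intro ω hω
    rw [Set.mem_ofPred_eq] at hω
    have hfin := srwLevelSet_finite hn b a ω
    rw [Set.ncard_eq_toFinset_card _ hfin] at hω
    obtain ⟨U, hU, hUk, hUK⟩ := hsub hfin.toFinset k (hkle.trans (by rw [hX]; gcongr))
    have hUD : ∀ x ∈ U, x ∈ srwLevelSet n b a ω := fun x hx => hfin.mem_toFinset.mp (hU hx)
    refine Set.mem_biUnion (x := U) ?_ ?_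
    · refine Finset.mem_coe.mpr (Finset.mem_filter.mpr ⟨Finset.mem_powersetCard.mpr
        ⟨fun x hx => Finset.mem_coe.mp (srwLevelSet_subset_box hn b a ω (hUD x hx)), hUk⟩, hUK⟩)
    · rw [Set.mem_ofPred_eq, Nat.cast_sum]
      calc (k : ℝ) * (n : ℝ) ^ b = ∑ _x ∈ U, (n : ℝ) ^ b := by simp [hUk]
        _ ≤ _ := Finset.sum_le_sum fun x hx => (hUD x hx).1
  have hterm : ∀ U ∈ 𝒰, (srwLaw d).real
      {ω | (k : ℝ) * (n : ℝ) ^ b ≤ ((∑ x ∈ U, srwLocalTime n x ω : ℕ) : ℝ)} ≤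
        Real.exp (k * (C / K)) * Real.exp (-(l * (k * (n : ℝ) ^ b))) := by
    intro U hU
    obtain ⟨hU1, hU2⟩ := Finset.mem_filter.mp hU
    refine (srwLaw_localTime_ge_le hd hK U hU2 n _).trans ?_
    gcongr
    have h3 : ∑ y ∈ U, srwPotential (0 - y) ≤ k * C := by
      calc ∑ y ∈ U, srwPotential (0 - y) ≤ ∑ _y ∈ U, C := Finset.sum_le_sum fun y _ => hpot _
        _ = k * C := by simp [(Finset.mem_powersetCard.mp hU1).2]
    calc 1 + (∑ y ∈ U, srwPotential (0 - y)) / K ≤ k * (C / K) + 1 := by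
          rw [add_comm, ← mul_div_assoc]; gcongr
      _ ≤ _ := Real.add_one_le_exp _
  have hcard : (𝒰.card : ℝ) ≤ Real.exp (k * (d * Real.log (2 * n + 1))) := by
    have h3 : 𝒰.card ≤ ((2 * n + 1) ^ d) ^ k := by
      refine (Finset.card_filter_le _ _).trans ?_
      rw [Finset.card_powersetCard, hbox, card_box]
      exact Nat.choose_le_pow _ _
    calc (𝒰.card : ℝ) ≤ (((2 * n + 1 : ℝ)) ^ d) ^ k := by exact_mod_cast h3
      _ = Real.exp (k * (d * Real.log (2 * n + 1))) := by
        rw [Real.exp_nat_mul, Real.exp_nat_mul, Real.exp_log (by positivity)]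
  calc (srwLaw d).real {ω | (n : ℝ) ^ γ * y < ((srwLevelSet n b a ω).ncard : ℝ)}
      ≤ (srwLaw d).real
          (⋃ U ∈ 𝒰, {ω | (k : ℝ) * (n : ℝ) ^ b ≤ ((∑ x ∈ U, srwLocalTime n x ω : ℕ) : ℝ)}) :=
        measureReal_mono hcover (measure_ne_top _ _)
    _ ≤ ∑ U ∈ 𝒰, (srwLaw d).real
          {ω | (k : ℝ) * (n : ℝ) ^ b ≤ ((∑ x ∈ U, srwLocalTime n x ω : ℕ) : ℝ)} :=
        measureReal_biUnion_finset_le _ _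
    _ ≤ ∑ _U ∈ 𝒰, Real.exp (k * (C / K)) * Real.exp (-(l * (k * (n : ℝ) ^ b))) :=
        Finset.sum_le_sum hterm
    _ = 𝒰.card * (Real.exp (k * (C / K)) * Real.exp (-(l * (k * (n : ℝ) ^ b)))) := by
        rw [Finset.sum_const, nsmul_eq_mul]
    _ ≤ Real.exp (k * (d * Real.log (2 * n + 1))) *
          (Real.exp (k * (C / K)) * Real.exp (-(l * (k * (n : ℝ) ^ b)))) := by gcongr
    _ = Real.exp (k * (d * Real.log (2 * n + 1) + C / K) - l * (k * (n : ℝ) ^ b)) := by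
        rw [← Real.exp_add, ← Real.exp_add]; congr 1; ring
    _ ≤ Real.exp (k * (l / 2 * (n : ℝ) ^ b) - l * (k * (n : ℝ) ^ b)) := by gcongr
    _ = Real.exp (-(l / 2 * (n : ℝ) ^ b * k)) := by congr 1; ring
    _ ≤ Real.exp (-(l / 2 * (n : ℝ) ^ b * (c * X / 2))) := by gcongr
    _ = _ := by
        rw [hX, Real.mul_rpow (by positivity) hy.le, ← Real.rpow_mul hn0.le,
          Real.rpow_add hn0, mul_comm γ α]
        congr 1; ring

theorem proposition1p6 (d : ℕ) (hd : 5 ≤ d) :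
    (∀ b γ δ ζ y : ℝ, 0 < b → 0 < γ → 0 < δ → 0 < ζ → 0 < y →
      ζ < (1 - 2 / (d : ℝ)) * γ + b - δ →
      (1 < γ + 2 * b ∨
        (γ + 2 * b = 1 ∧ 1 + ∑' x : Fin d → ℤ, srwGreen d x ^ 2 < ENNReal.ofReal y) ∨
        2 / (d : ℝ) * γ < b) →
      ∀ᶠ n : ℕ in atTop,
        (srwLaw d).real {ω | (n : ℝ) ^ γ * y < ((srwLevelSet n b (b + δ) ω).ncard : ℝ)} ≤
          Real.exp (-(n : ℝ) ^ ζ)) ∧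
    (∃ κ : ℝ, 0 < κ ∧ ∀ b γ δ y : ℝ, 0 < b → 0 < γ → 0 < δ → 0 < y →
      2 / (d : ℝ) * γ < b →
      ∀ᶠ n : ℕ in atTop,
        (srwLaw d).real {ω | (n : ℝ) ^ γ * y < ((srwLevelSet n b (b + δ) ω).ncard : ℝ)} ≤
          Real.exp (-(κ * y ^ (1 - 2 / (d : ℝ)) * (n : ℝ) ^ ((1 - 2 / (d : ℝ)) * γ + b)))) := by
  obtain ⟨κ, hκ, h⟩ := exists_srwLaw_levelSet_le (d := d) (by omega)
  refine ⟨fun b γ δ ζ y hb hγ hδ _ hy hζ _ => ?_,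
    κ, hκ, fun b γ δ y hb hγ _ hy _ => h b γ (b + δ) y hb hγ hy⟩
  set β := (1 - 2 / (d : ℝ)) * γ + b with hβ
  -- Since `ζ < β - δ < β`, a positive power of `n` is left over to absorb the constant.
  have hlim : Tendsto (fun n : ℕ => κ * y ^ (1 - 2 / (d : ℝ)) * (n : ℝ) ^ (β - ζ)) atTop atTop :=
    ((tendsto_rpow_atTop (by linarith)).comp tendsto_natCast_atTop_atTop).const_mul_atTop
      (by positivity)
  filter_upwards [h b γ (b + δ) y hb hγ hy, hlim.eventually_ge_atTop 1, eventually_ge_atTop 1]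
    with n h1 h2 hn
  have hn0 : (0 : ℝ) < n := by exact_mod_cast hn
  refine h1.trans (Real.exp_le_exp.mpr (neg_le_neg ?_))
  calc (n : ℝ) ^ ζ = 1 * (n : ℝ) ^ ζ := (one_mul _).symm
    _ ≤ κ * y ^ (1 - 2 / (d : ℝ)) * (n : ℝ) ^ (β - ζ) * (n : ℝ) ^ ζ := by gcongr
    _ = κ * y ^ (1 - 2 / (d : ℝ)) * (n : ℝ) ^ β := by
        rw [mul_assoc, ← Real.rpow_add hn0, sub_add_cancel]
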